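/- Setting. Let $u(t)\in\mathbb{R}^m$ and $e(t)\in\mathbb{R}^p$ ($t\in\mathbb{Z}$) be jointly quasi-stationary signals: with $\kappa(t)=\begin{bmatrix}u(t)\\e(t)\end{bmatrix}$, the second moments of $\kappa(t)$ are bounded uniformly in $t$ and the correlations $R_\kappa(\tau)=\bar{\mathbb{E}}\,\kappa(t)\kappa(t-\tau)^T$ exist for all $\tau\in\mathbb{Z}$, where $\bar{\mathbb{E}}f(t):=\lim_{N\to\infty}\frac1N\sum_{t=1}^N\mathbb{E}f(t)$. Let $e$ be white noise ($\bar{\mathbb{E}}\,e(t)e(t-\tau)^T=0$ for $\tau\neq0$), uncorrelated with present and past inputs ($\bar{\mathbb{E}}\,e(t)u(t-\tau)^T=0$ for $\tau\ge0$). A transfer matrix is a matrix of causal linear time-invariant filters $\sum_{k\ge0}g_kq^{-k}$ with real coefficients (for instance proper rational ones); it is stable if every entry has $\sum_k|g_k|<\infty$, and a square one is monic if its coefficient at $q^0$ is $I$. The data are generated by $$y(t)=G^0(q)u(t)+H^0(q)e(t),$$ with $G^0$ ($p\times m$) stable and $H^0$ ($p\times p$) monic, stable and stably invertible. Consider a parametrized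 model set $M(q,\theta)=[G(q,\theta)\ \ H(q,\theta)]$, $\theta\in\Theta\subset\mathbb{R}^n$, with $G(q,\theta)$ stable and $H(q,\theta)$ monic, stable and stably invertible for every $\theta\in\Theta$, which contains the system: $M(q,\theta_0)=M^0(q):=[G^0(q)\ \ H^0(q)]$ for some $\theta_0\in\Theta$. Let $$\varepsilon(t,\theta)=y(t)-\Big[\big(I-H(q,\theta)^{-1}\big)y(t)+H(q,\theta)^{-1}G(q,\theta)u(t)\Big],\qquad V(\theta)=\bar{\mathbb{E}}\,\varepsilon(t,\theta)^TQ\,\varepsilon(t,\theta),$$ be the one-step-ahead prediction error and the prediction-error cost, with $Q$ any positive definite weighting matrix. For $\ell=1,\dots,p$ let $\kappa^{[\ell]}$ be the vector of those components $\kappa_j$ of $\kappa$ for which the entry $M_{\ell j}(q,\theta)$ is not structurally zero, i.e. is nonzero for some $\theta\in\Theta$. Suppose that $\kappa^{[\ell]}$ has a spectrum $\Phi_{\kappa^{[\ell]}}$, i.e. an integrable matrix function on $(-\pi,\pi]$ with $\bar{\mathbb{E}}\,\kappa^{[\ell]}(t)\kappa^{[\ell]}(t-\tau)^T=\frac1{2\pi}\int_{-\pi}^{\pi}\Phi_{\kappa^{[\ell]}}(\omega)e^{i\omega\tau}\,d\omega$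 for all $\tau\in\mathbb{Z}$. Proposition. Suppose the rows $M_\ell(q,\theta)$ of the model are independently parametrized, i.e. no two rows depend on a common component of $\theta$. If, for every $\ell=1,\dots,p$, $\Phi_{\kappa^{[\ell]}}(\omega)\succ0$ for almost all $\omega$, then the cost $V(\theta)$ exists for all $\theta\in\Theta$, and $M(q,\theta)=M^0(q)$ is its unique minimum: a parameter $\theta\in\Theta$ minimizes $V$ over $\Theta$ if and only if $M(q,\theta)=M^0(q)$. -/

import Mathlib

open MeasureTheory Filter Topology

open scoped Matrix ComplexOrder

noncomputable section

namespace PredErr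

/-- A transfer function of a causal linear time-invariant system is represented by its expansion
`g₀ + g₁ q⁻¹ + g₂ q⁻² + ⋯` in the delay operator `X = q⁻¹`; the coefficients are the impulse
response.  Every proper rational transfer function has such an expansion. -/
abbrev TF : Type := PowerSeries ℝ

/-- A vector signal in discrete time: time, then realization, then component.  A deterministic
signal is one on a one-point probability space, and a signal that starts at a finite time is
extended by zero. -/
abbrev Signal (Ω : Type*) (ι : Type*) : Type _ := ℤ → Ω → ι → ℝ

/-- Stability of a transfer matrix: all impulse responses are absolutely summable.  For rational
entries this says exactly that all poles lie in the open unit disc. -/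
def IsStable {α β : Type*} (F : Matrix α β TF) : Prop :=
  ∀ i j, Summable fun k : ℕ => |PowerSeries.coeff k (F i j)|

/-- A square transfer matrix is monic if its direct feed-through term is the identity. -/
def IsMonic {α : Type*} [DecidableEq α] (H : Matrix α α TF) : Prop :=
  H.map PowerSeries.constantCoeff = 1

/-- The standing assumptions on a pair `(G, H)`: `G` is stable, and `H` is monic, stable and stably
invertible.  (A monic matrix is invertible over the power series, so `H⁻¹` is its true inverse.) -/
structure IsAdmissible {p m : ℕ} (G : Matrix (Fin p) (Fin m) TF)
    (H : Matrix (Fin p) (Fin p) TF) : Prop where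
  stable_G : IsStable G
  monic_H : IsMonic H
  stable_H : IsStable H
  stable_H_inv : IsStable H⁻¹

/-- The filtered signal `F(q) s(t) = ∑ₖ Fₖ s(t - k)`. -/
def filt {Ω α β : Type*} [Fintype β] (F : Matrix α β TF) (s : Signal Ω β) : Signal Ω α :=
  fun t ω i => ∑ j, ∑' k : ℕ, PowerSeries.coeff k (F i j) * s (t - k) ω j

/-- The combined matrix `M = [G H]`. -/
abbrev combined {p m : ℕ} (G : Matrix (Fin p) (Fin m) TF) (H : Matrix (Fin p) (Fin p) TF) :
    Matrix (Fin p) (Fin m ⊕ Fin p) TF :=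
  Matrix.fromCols G H

/-- Stacking of two vector signals. -/
def stack {Ω α β : Type*} (u : Signal Ω α) (e : Signal Ω β) : Signal Ω (α ⊕ β) :=
  fun t ω => Sum.elim (u t ω) (e t ω)

/-- The predictor filter `W = [I - H⁻¹   H⁻¹ G]`. -/
def predictorFilter {p m : ℕ} (G : Matrix (Fin p) (Fin m) TF) (H : Matrix (Fin p) (Fin p) TF) :
    Matrix (Fin p) (Fin p ⊕ Fin m) TF :=
  Matrix.fromCols (1 - H⁻¹) (H⁻¹ * G)

/-- The one-step-ahead prediction error `ε(t) = y(t) - W(q) z(t)`, `z = (y, u)`. -/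
def predictionError {Ω : Type*} {p m : ℕ} (G : Matrix (Fin p) (Fin m) TF)
    (H : Matrix (Fin p) (Fin p) TF) (y : Signal Ω (Fin p)) (u : Signal Ω (Fin m)) :
    Signal Ω (Fin p) :=
  fun t ω => y t ω - filt (predictorFilter G H) (stack y u) t ω

variable {Ω : Type*} [MeasurableSpace Ω]

/-- The generalized expectation `Ē f(t) = lim_{N → ∞} (1/N) ∑_{t=1}^N E f(t)` exists and equals
`v`. -/
def HasGenExp (P : Measure Ω) (f : ℤ → Ω → ℝ) (v : ℝ) : Prop :=
  (∀ t, Integrable (f t) P) ∧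
    Tendsto (fun N : ℕ => (N : ℝ)⁻¹ * ∑ t ∈ Finset.Icc (1 : ℤ) N, ∫ ω, f t ω ∂P) atTop (𝓝 v)

/-- `R` is the correlation function of `s`: `R(τ) = Ē s(t) s(t - τ)ᵀ`. -/
def IsCorrelation {ι : Type*} (P : Measure Ω) (s : Signal Ω ι) (R : ℤ → Matrix ι ι ℝ) : Prop :=
  ∀ (τ : ℤ) (i j : ι), HasGenExp P (fun t ω => s t ω i * s (t - τ) ω j) (R τ i j)

/-- Quasi-stationary signals: second moments bounded uniformly in time (hence bounded means), and
all correlations `Ē s(t) s(t - τ)ᵀ` exist. -/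
structure IsQuasiStationary {ι : Type*} (P : Measure Ω) (s : Signal Ω ι) : Prop where
  memLp : ∀ t i, MemLp (fun ω => s t ω i) 2 P
  bounded : ∃ C : ℝ, ∀ t i, ∫ ω, (s t ω i) ^ 2 ∂P ≤ C
  correlation : ∃ R : ℤ → Matrix ι ι ℝ, IsCorrelation P s R

/-- `Φ` is the spectrum (spectral density matrix) of `s`: an integrable function on `(-π, π]`
whose Fourier series is `∑_τ R(τ) e^{-iωτ}`, where `R` is the correlation function of `s`. -/
def IsSpectrum {ι : Type*} (P : Measure Ω) (s : Signal Ω ι) (Φ : ℝ → Matrix ι ι ℂ) : Prop :=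
  (∀ i j, IntervalIntegrable (fun w => Φ w i j) volume (-Real.pi) Real.pi) ∧
    ∃ R : ℤ → Matrix ι ι ℝ, IsCorrelation P s R ∧
      ∀ (τ : ℤ) (i j : ι), (R τ i j : ℂ) =
        (2 * Real.pi : ℂ)⁻¹ *
          ∫ w in (-Real.pi)..Real.pi, Complex.exp (Complex.I * w * τ) * Φ w i j

/-- `Φ(ω) ≻ 0` for almost all frequencies. -/
def PosDefAE {ι : Type*} (Φ : ℝ → Matrix ι ι ℂ) : Prop :=
  ∀ᵐ w ∂(volume.restrict (Set.Ioc (-Real.pi) Real.pi)), (Φ w).PosDef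

/-- Whiteness: `Ē e(t) e(t - τ)ᵀ = 0` for all `τ ≠ 0`.  It holds in particular whenever
`E e(t) e(s)ᵀ = 0` for all `t ≠ s`. -/
def IsWhite {ι : Type*} (P : Measure Ω) (e : Signal Ω ι) : Prop :=
  ∀ τ : ℤ, τ ≠ 0 → ∀ i j, HasGenExp P (fun t ω => e t ω i * e (t - τ) ω j) 0

/-- `e(t)` is uncorrelated with the present and past input `uᵗ`: `Ē e(t) u(t - τ)ᵀ = 0` for all
`τ ≥ 0`.  It holds when `u` and `e` are uncorrelated (open loop), and for inputs generated by
delayed feedback from the outputs and signals uncorrelated with `e`. -/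
def IsUncorrelatedWithPast {α β : Type*} (P : Measure Ω) (e : Signal Ω α) (u : Signal Ω β) :
    Prop :=
  ∀ τ : ℤ, 0 ≤ τ → ∀ i j, HasGenExp P (fun t ω => e t ω i * u (t - τ) ω j) 0

variable {n p : ℕ} {κ : Type*}

/-- The rows of `M(q, θ)`, `θ ∈ Θ`, are independently parametrized: there are pairwise disjoint
sets of components of `θ` such that row `ℓ` depends only on the components in the `ℓ`-th set. -/
def IndependentRows (Θ : Set (Fin n → ℝ)) (M : (Fin n → ℝ) → Matrix (Fin p) κ TF) : Prop :=
  ∃ I : Fin p → Set (Fin n), Pairwise (fun ℓ ℓ' => Disjoint (I ℓ) (I ℓ')) ∧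
    ∀ ℓ, ∀ θ ∈ Θ, ∀ θ' ∈ Θ, (∀ i ∈ I ℓ, θ i = θ' i) → M θ ℓ = M θ' ℓ

/-- The columns of the entries of row `ℓ` that are not identically zero in the model set. -/
def rowSupport (Θ : Set (Fin n → ℝ)) (M : (Fin n → ℝ) → Matrix (Fin p) κ TF) (ℓ : Fin p) : Set κ :=
  {j | ∃ θ ∈ Θ, M θ ℓ j ≠ 0}

/-- The sub-vector of a signal with components in `S`. -/
def subSignal {Ω κ : Type*} (s : Signal Ω κ) (S : Set κ) : Signal Ω S :=
  fun t ω j => s t ω j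

end PredErr

end

/-! With κ = (u, e), M = [G H] and D = H⁻¹(M⁰ - M), algebra gives ε(t,θ) = e(t) + w(t), where w = D
κ (`represents_predictionError`). As H⁰ and H are both monic, the e-columns of D have no direct term
(`coeff_zero_mismatch_inr`). So w(t) involves only past e and present and past u, all uncorrelated
with e(t), and V(θ) = c + Ē wᵀQw with c = Ē eᵀQe independent of θ (`cost_decomposition`). Since D =
0 at θ₀, c is the minimum of V.

Conversely, V(θ) = c forces Ē wᵀQw = 0, so every component of w has zero mean power
(`isNull_of_posDef`). Stable filters preserve this, so every row of H w = (M⁰ - M) κ has zero mean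
power. The power of row ℓ is the integral of the quadratic form of Φ at the frequency responses of
the row of M⁰ - M. Positive definiteness makes these responses vanish almost everywhere, and Fourier
uniqueness makes the filters vanish (`eq_zero_of_isNull_of_support`).

The analysis treats each signal component as a norm-bounded sequence in the Hilbert space L²(P),
where expectations of products are inner products. The limit in Ē passes through the infinite filter
sums by dominated convergence (`MeanInner.act_right`). -/

namespace PredErr

/-! ### Absolutely summable transfer functions -/

/-- A scalar transfer function with absolutely summable impulse response. -/
def AbsSummable (f : TF) : Prop := Summable fun k : ℕ => |PowerSeries.coeff k f|

theorem AbsSummable.add {f g : TF} (hf : AbsSummable f) (hg : AbsSummable g) :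
    AbsSummable (f + g) :=
  Summable.of_nonneg_of_le (fun _ => abs_nonneg _)
    (fun k => by simpa using abs_add_le (PowerSeries.coeff k f) (PowerSeries.coeff k g))
    (Summable.add hf hg)

theorem AbsSummable.neg {f : TF} (hf : AbsSummable f) : AbsSummable (-f) := by
  simpa [AbsSummable] using hf

theorem AbsSummable.sub {f g : TF} (hf : AbsSummable f) (hg : AbsSummable g) :
    AbsSummable (f - g) := by
  rw [sub_eq_add_neg]
  exact hf.add hg.neg

theorem AbsSummable.mul {f g : TF} (hf : AbsSummable f) (hg : AbsSummable g) :
    AbsSummable (f * g) := by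
  have h := summable_norm_sum_mul_antidiagonal_of_summable_norm
    (f := fun k => PowerSeries.coeff k f) (g := fun k => PowerSeries.coeff k g) hf hg
  simpa [AbsSummable, PowerSeries.coeff_mul] using h

theorem absSummable_zero : AbsSummable 0 := by
  simp [AbsSummable]

theorem absSummable_one : AbsSummable 1 :=
  summable_of_ne_finset_zero (s := {0}) fun k hk => by
    simp [PowerSeries.coeff_one, Finset.notMem_singleton.1 hk]

theorem absSummable_sum {ι : Type*} (s : Finset ι) {f : ι → TF}
    (hf : ∀ i ∈ s, AbsSummable (f i)) : AbsSummable (∑ i ∈ s, f i) :=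
  Finset.sum_induction f AbsSummable (fun _ _ => AbsSummable.add) absSummable_zero hf

section IsStable

variable {α β γ : Type*} {F F' : Matrix α β TF}

theorem IsStable.absSummable (hF : IsStable F) (i : α) (j : β) : AbsSummable (F i j) := hF i j

theorem IsStable.sub (hF : IsStable F) (hF' : IsStable F') : IsStable (F - F') :=
  fun i j => (hF.absSummable i j).sub (hF'.absSummable i j)

theorem IsStable.mul [Fintype β] {K : Matrix β γ TF} (hF : IsStable F) (hK : IsStable K) :
    IsStable (F * K) :=
  fun i j => absSummable_sum _ fun l _ => (hF.absSummable i l).mul (hK.absSummable l j)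

theorem isStable_one [DecidableEq α] : IsStable (1 : Matrix α α TF) := by
  intro i j
  change AbsSummable ((1 : Matrix α α TF) i j)
  rcases eq_or_ne i j with rfl | h
  · rw [Matrix.one_apply_eq]
    exact absSummable_one
  · rw [Matrix.one_apply_ne h]
    exact absSummable_zero

theorem isStable_zero : IsStable (0 : Matrix α β TF) := fun _ _ => absSummable_zero

theorem IsStable.fromCols {K : Matrix α γ TF} (hF : IsStable F) (hK : IsStable K) :
    IsStable (Matrix.fromCols F K) := by
  rintro i (j | j)
  · exact hF i j
  · exact hK i j

theorem IsStable.fromRows {K : Matrix γ β TF} (hF : IsStable F) (hK : IsStable K) :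
    IsStable (Matrix.fromRows F K) := by
  rintro (i | i) j
  · exact hF i j
  · exact hK i j

end IsStable

/-! ### Filtering bounded sequences in a Hilbert space -/

section Hilbert

variable {E : Type*} [NormedAddCommGroup E]

/-- A two-sided sequence that is bounded in norm. -/
def IsBdd (x : ℤ → E) : Prop := ∃ C, ∀ t, ‖x t‖ ≤ C

theorem IsBdd.add {x y : ℤ → E} (hx : IsBdd x) (hy : IsBdd y) : IsBdd fun t => x t + y t := by
  obtain ⟨C, hC⟩ := hx
  obtain ⟨D, hD⟩ := hy
  exact ⟨C + D, fun t => (norm_add_le _ _).trans (add_le_add (hC t) (hD t))⟩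

theorem isBdd_zero : IsBdd fun _ => (0 : E) := ⟨0, fun _ => by simp⟩

theorem IsBdd.sum {ι : Type*} (s : Finset ι) {x : ι → ℤ → E} (hx : ∀ i ∈ s, IsBdd (x i)) :
    IsBdd fun t => ∑ i ∈ s, x i t := by
  classical
  induction s using Finset.induction_on with
  | empty => simpa using isBdd_zero
  | insert a s ha ih =>
    simp_rw [Finset.sum_insert ha]
    exact (hx a (by simp)).add (ih fun i hi => hx i (by simp [hi]))

theorem IsBdd.delay {x : ℤ → E} (hx : IsBdd x) (k : ℤ) : IsBdd fun t => x (t - k) := by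
  obtain ⟨C, hC⟩ := hx
  exact ⟨C, fun t => hC _⟩

variable [InnerProductSpace ℝ E]

theorem IsBdd.smul {x : ℤ → E} (hx : IsBdd x) (c : ℝ) : IsBdd fun t => c • x t := by
  obtain ⟨C, hC⟩ := hx
  refine ⟨|c| * C, fun t => ?_⟩
  rw [norm_smul, Real.norm_eq_abs]
  exact mul_le_mul_of_nonneg_left (hC t) (abs_nonneg c)

/-- The filtered sequence `f(q) x(t) = ∑ₖ fₖ x(t - k)`. -/
noncomputable def act (f : TF) (x : ℤ → E) : ℤ → E :=
  fun t => ∑' k : ℕ, PowerSeries.coeff k f • x (t - k)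

theorem norm_act_term_le (f : TF) {x : ℤ → E} {C : ℝ} (hC : ∀ t, ‖x t‖ ≤ C) (t : ℤ) (k : ℕ) :
    ‖PowerSeries.coeff k f • x (t - k)‖ ≤ |PowerSeries.coeff k f| * C := by
  rw [norm_smul, Real.norm_eq_abs]
  exact mul_le_mul_of_nonneg_left (hC _) (abs_nonneg _)

theorem act_summable_norm {f : TF} (hf : AbsSummable f) {x : ℤ → E} (hx : IsBdd x) (t : ℤ) :
    Summable fun k : ℕ => ‖PowerSeries.coeff k f • x (t - k)‖ := by
  obtain ⟨C, hC⟩ := hx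
  exact Summable.of_nonneg_of_le (fun _ => norm_nonneg _) (norm_act_term_le f hC t)
    (Summable.mul_right C hf)

theorem IsBdd.act {f : TF} (hf : AbsSummable f) {x : ℤ → E} (hx : IsBdd x) :
    IsBdd (act f x) := by
  have hs := act_summable_norm hf hx
  obtain ⟨C, hC⟩ := hx
  exact ⟨∑' k : ℕ, |PowerSeries.coeff k f| * C, fun t => (norm_tsum_le_tsum_norm (hs t)).trans
    ((hs t).tsum_le_tsum (norm_act_term_le f hC t) (Summable.mul_right C hf))⟩

@[simp] theorem act_zero_left (x : ℤ → E) : act 0 x = fun _ => 0 := by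
  funext t
  simp [act]

@[simp] theorem act_one_left (x : ℤ → E) : act 1 x = x := by
  funext t
  rw [act, tsum_eq_single 0]
  · simp
  · intro k hk
    simp [PowerSeries.coeff_one, hk]

/-- Filtering of a family of sequences by a transfer matrix. -/
noncomputable def mact {α β : Type*} [Fintype β] (F : Matrix α β TF) (x : β → ℤ → E) :
    α → ℤ → E :=
  fun i t => ∑ j, act (F i j) (x j) t

theorem IsBdd.mact {α β : Type*} [Fintype β] {x : β → ℤ → E} {F : Matrix α β TF}
    (hF : IsStable F) (hx : ∀ j, IsBdd (x j)) (i : α) : IsBdd (mact F x i) :=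
  IsBdd.sum _ fun j _ => (hx j).act (hF.absSummable i j)

variable [CompleteSpace E]

theorem act_summable {f : TF} (hf : AbsSummable f) {x : ℤ → E} (hx : IsBdd x) (t : ℤ) :
    Summable fun k : ℕ => PowerSeries.coeff k f • x (t - k) :=
  (act_summable_norm hf hx t).of_norm

theorem act_sub_left {f g : TF} (hf : AbsSummable f) (hg : AbsSummable g) {x : ℤ → E}
    (hx : IsBdd x) (t : ℤ) : act (f - g) x t = act f x t - act g x t := by
  simp only [act, map_sub, sub_smul]
  exact (act_summable hf hx t).tsum_sub (act_summable hg hx t)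

theorem act_add_left {f g : TF} (hf : AbsSummable f) (hg : AbsSummable g) {x : ℤ → E}
    (hx : IsBdd x) (t : ℤ) : act (f + g) x t = act f x t + act g x t := by
  simp only [act, map_add, add_smul]
  exact (act_summable hf hx t).tsum_add (act_summable hg hx t)

theorem act_add_right {f : TF} (hf : AbsSummable f) {x y : ℤ → E}
    (hx : IsBdd x) (hy : IsBdd y) (t : ℤ) :
    act f (fun t => x t + y t) t = act f x t + act f y t := by
  simp only [act, smul_add]
  exact (act_summable hf hx t).tsum_add (act_summable hf hy t)

theorem act_sum_left {ι : Type*} (s : Finset ι) {f : ι → TF} (hf : ∀ i ∈ s, AbsSummable (f i))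
    {x : ℤ → E} (hx : IsBdd x) (t : ℤ) :
    act (∑ i ∈ s, f i) x t = ∑ i ∈ s, act (f i) x t := by
  classical
  induction s using Finset.induction_on with
  | empty => simp
  | insert a s ha ih =>
    have h : ∀ i ∈ s, AbsSummable (f i) := fun i hi => hf i (by simp [hi])
    rw [Finset.sum_insert ha, Finset.sum_insert ha,
      act_add_left (hf a (by simp)) (absSummable_sum s h) hx, ih h]

theorem act_sum_right {ι : Type*} (s : Finset ι) {f : TF} (hf : AbsSummable f)
    {x : ι → ℤ → E} (hx : ∀ i, IsBdd (x i)) (t : ℤ) :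
    act f (fun t => ∑ i ∈ s, x i t) t = ∑ i ∈ s, act f (x i) t := by
  classical
  induction s using Finset.induction_on with
  | empty => simp [act]
  | insert a s ha ih =>
    simp_rw [Finset.sum_insert ha]
    rw [act_add_right hf (hx a) (IsBdd.sum s fun i _ => hx i), ih]

/-- Both sides sum one absolutely convergent family over pairs of delays: row by row for the
composition, along antidiagonals for the product. -/
theorem act_mul {f g : TF} (hf : AbsSummable f) (hg : AbsSummable g) {x : ℤ → E}
    (hx : IsBdd x) (t : ℤ) : act (f * g) x t = act f (act g x) t := by
  have hsum : Summable fun z : ℕ × ℕ =>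
      (PowerSeries.coeff z.1 f * PowerSeries.coeff z.2 g) • x (t - z.1 - z.2) := by
    obtain ⟨C, hC⟩ := hx
    have h := (Summable.mul_of_nonneg hf hg (fun _ => abs_nonneg _)
      fun _ => abs_nonneg _).mul_right C
    refine Summable.of_norm_bounded h fun z => ?_
    rw [norm_smul, Real.norm_eq_abs, abs_mul]
    exact mul_le_mul_of_nonneg_left (hC _) (by positivity)
  have hR : act f (act g x) t = ∑' z : ℕ × ℕ,
      (PowerSeries.coeff z.1 f * PowerSeries.coeff z.2 g) • x (t - z.1 - z.2) := by
    rw [hsum.tsum_prod]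
    simp only [act, mul_smul]
    exact tsum_congr fun k => ((act_summable hg hx (t - k)).tsum_const_smul _).symm
  rw [hR, ← Finset.HasAntidiagonal.sigmaAntidiagonalEquivProd.tsum_eq]
  refine Eq.trans ?_ (((Finset.HasAntidiagonal.sigmaAntidiagonalEquivProd.summable_iff).2
    hsum).tsum_sigma' fun n => (hasSum_fintype _).summable).symm
  refine tsum_congr fun n => ?_
  rw [PowerSeries.coeff_mul, Finset.sum_smul, tsum_fintype]
  rw [← Finset.sum_coe_sort]
  refine Finset.sum_congr rfl fun z _ => ?_
  have hz := Finset.HasAntidiagonal.mem_antidiagonal.1 z.2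
  simp only [Function.comp, Finset.HasAntidiagonal.sigmaAntidiagonalEquivProd_apply]
  congr 2
  omega

section mact

variable {α β γ : Type*} [Fintype β] {x : β → ℤ → E}

theorem mact_sub {F F' : Matrix α β TF} (hF : IsStable F) (hF' : IsStable F')
    (hx : ∀ j, IsBdd (x j)) (i : α) (t : ℤ) :
    mact (F - F') x i t = mact F x i t - mact F' x i t := by
  simp only [mact, Matrix.sub_apply, ← Finset.sum_sub_distrib]
  exact Finset.sum_congr rfl fun j _ =>
    act_sub_left (hF.absSummable i j) (hF'.absSummable i j) (hx j) t

theorem mact_mul [Fintype γ] {K : Matrix γ α TF} {F : Matrix α β TF} [Fintype α]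
    (hK : IsStable K) (hF : IsStable F) (hx : ∀ j, IsBdd (x j)) :
    mact (K * F) x = mact K (mact F x) := by
  funext i t
  have h1 : ∀ j, act ((K * F) i j) (x j) t = ∑ l, act (K i l) (act (F l j) (x j)) t := by
    intro j
    rw [Matrix.mul_apply, act_sum_left _ (fun l _ => (hK.absSummable i l).mul
      (hF.absSummable l j)) (hx j)]
    exact Finset.sum_congr rfl fun l _ =>
      act_mul (hK.absSummable i l) (hF.absSummable l j) (hx j) t
  simp only [mact, h1]
  rw [Finset.sum_comm]
  refine Finset.sum_congr rfl fun l _ => ?_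
  exact (act_sum_right _ (hK.absSummable i l)
    (fun j => (hx j).act (hF.absSummable l j)) t).symm

end mact

end Hilbert

/-! ### Time averages -/

/-- The average of the first `N` values `g 1, …, g N`. -/
noncomputable def avg (g : ℤ → ℝ) (N : ℕ) : ℝ := (N : ℝ)⁻¹ * ∑ t ∈ Finset.Icc (1 : ℤ) N, g t

/-- The sequence `g` has time average `v`. -/
def HasMean (g : ℤ → ℝ) (v : ℝ) : Prop := Tendsto (avg g) atTop (𝓝 v)

theorem avg_add (g h : ℤ → ℝ) (N : ℕ) : avg (fun t => g t + h t) N = avg g N + avg h N := by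
  simp [avg, Finset.sum_add_distrib, mul_add]

theorem avg_const_mul (c : ℝ) (g : ℤ → ℝ) (N : ℕ) : avg (fun t => c * g t) N = c * avg g N := by
  simp only [avg, ← Finset.mul_sum]
  ring

theorem avg_mono {g h : ℤ → ℝ} (hgh : ∀ t, g t ≤ h t) (N : ℕ) : avg g N ≤ avg h N :=
  mul_le_mul_of_nonneg_left (Finset.sum_le_sum fun t _ => hgh t) (by positivity)

theorem abs_avg_le {g : ℤ → ℝ} {C : ℝ} (hC : ∀ t, |g t| ≤ C) (N : ℕ) : |avg g N| ≤ C := by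
  have hC0 : 0 ≤ C := (abs_nonneg _).trans (hC 0)
  rcases Nat.eq_zero_or_pos N with rfl | hN
  · simpa [avg] using hC0
  rw [avg, abs_mul, abs_of_nonneg (by positivity), inv_mul_le_iff₀ (by positivity)]
  refine (Finset.abs_sum_le_sum_abs _ _).trans ((Finset.sum_le_sum fun t _ => hC t).trans ?_)
  simp

theorem HasMean.add {g h : ℤ → ℝ} {v w : ℝ} (hg : HasMean g v) (hh : HasMean h w) :
    HasMean (fun t => g t + h t) (v + w) :=
  (Tendsto.add hg hh).congr fun N => (avg_add g h N).symm

theorem HasMean.const_mul {g : ℤ → ℝ} {v : ℝ} (c : ℝ) (hg : HasMean g v) :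
    HasMean (fun t => c * g t) (c * v) :=
  (Tendsto.const_mul c hg).congr fun N => (avg_const_mul c g N).symm

theorem hasMean_zero : HasMean (fun _ => 0) 0 := by
  refine tendsto_const_nhds.congr fun N => ?_
  simp [avg]

theorem HasMean.sum {ι : Type*} (s : Finset ι) {g : ι → ℤ → ℝ} {v : ι → ℝ}
    (h : ∀ i ∈ s, HasMean (g i) (v i)) : HasMean (fun t => ∑ i ∈ s, g i t) (∑ i ∈ s, v i) := by
  classical
  induction s using Finset.induction_on with
  | empty => simpa using hasMean_zero
  | insert a s ha ih =>
    simp_rw [Finset.sum_insert ha]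
    exact (h a (by simp)).add (ih fun i hi => h i (by simp [hi]))

theorem HasMean.nonneg {g : ℤ → ℝ} {v : ℝ} (hg : HasMean g v) (h : ∀ t, 0 ≤ g t) : 0 ≤ v :=
  ge_of_tendsto' hg fun _ => mul_nonneg (by positivity) (Finset.sum_nonneg fun t _ => h t)

theorem HasMean.zero_of_abs_le {g h : ℤ → ℝ} (hh : HasMean h 0) (hgh : ∀ t, |g t| ≤ h t) :
    HasMean g 0 := by
  refine squeeze_zero_norm (fun N => ?_) hh
  rw [Real.norm_eq_abs, abs_le]
  constructor
  · have := avg_mono (g := fun t => -1 * h t) (h := g)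
      (fun t => by linarith [(abs_le.1 (hgh t)).1]) N
    rw [avg_const_mul] at this
    linarith
  · exact avg_mono (fun t => (abs_le.1 (hgh t)).2) N

theorem sum_Icc_succ (g : ℤ → ℝ) (N : ℕ) :
    ∑ t ∈ Finset.Icc (1 : ℤ) ((N + 1 : ℕ) : ℤ), g t = (∑ t ∈ Finset.Icc (1 : ℤ) N, g t) + g (N + 1)
    := by
  have h : Finset.Icc (1 : ℤ) ((N + 1 : ℕ) : ℤ) = insert ((N : ℤ) + 1) (Finset.Icc (1 : ℤ) N) := by
    ext t
    simp only [Finset.mem_Icc, Finset.mem_insert]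
    omega
  rw [h, Finset.sum_insert (by simp), add_comm]

theorem sum_sub_pred (g : ℤ → ℝ) (N : ℕ) :
    ∑ t ∈ Finset.Icc (1 : ℤ) N, g (t - 1) = (∑ t ∈ Finset.Icc (1 : ℤ) N, g t) + g 0 - g N := by
  induction N with
  | zero => simp
  | succ N ih =>
    rw [sum_Icc_succ, sum_Icc_succ g, ih]
    push_cast
    rw [add_sub_cancel_right]
    ring

/-- The difference of the sums telescopes to g 0 - g N, which is at most 2C and is divided by N. -/
theorem tendsto_avg_pred_sub {g : ℤ → ℝ} {C : ℝ} (hC : ∀ t, |g t| ≤ C) :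
    Tendsto (fun N => avg (fun t => g (t - 1)) N - avg g N) atTop (𝓝 0) := by
  have h : Tendsto (fun N : ℕ => (N : ℝ)⁻¹ * (2 * C)) atTop (𝓝 0) := by
    simpa using tendsto_inv_atTop_nhds_zero_nat.mul_const (2 * C)
  refine squeeze_zero_norm (fun N => ?_) h
  have hN : avg (fun t => g (t - 1)) N - avg g N = (N : ℝ)⁻¹ * (g 0 - g N) := by
    rw [avg, avg, sum_sub_pred]
    ring
  rw [hN, Real.norm_eq_abs, abs_mul, abs_of_nonneg (by positivity)]
  refine mul_le_mul_of_nonneg_left ?_ (by positivity)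
  have h1 := abs_le.1 (hC 0)
  have h2 := abs_le.1 (hC N)
  exact abs_le.2 ⟨by linarith, by linarith⟩

theorem HasMean.delay {g : ℤ → ℝ} {v : ℝ} (hg : HasMean g v) (hb : ∃ C, ∀ t, |g t| ≤ C) (k : ℤ) :
    HasMean (fun t => g (t - k)) v := by
  obtain ⟨C, hC⟩ := hb
  induction k using Int.induction_on with
  | zero => simpa using hg
  | succ k ih =>
    have h := (tendsto_avg_pred_sub (g := fun t => g (t - k)) fun t => hC _).add ih
    simp only [sub_add_cancel, zero_add] at h
    refine h.congr fun N => ?_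
    congr 1
    funext t
    congr 1
    ring
  | pred k ih =>
    have h := ih.sub (tendsto_avg_pred_sub (g := fun t => g (t - (-k - 1))) fun t => hC _)
    rw [sub_zero] at h
    refine h.congr fun N => ?_
    have e : (fun t : ℤ => g (t - 1 - (-k - 1))) = fun t => g (t - -k) := by
      funext t
      congr 1
      ring
    rw [e]
    ring

/-! ### Correlations of bounded sequences in a Hilbert space -/

section Hilbert

variable {E : Type*} [NormedAddCommGroup E] [InnerProductSpace ℝ E]

/-- The time average of `⟪a t, b t⟫` is `v`. -/
def MeanInner (a b : ℤ → E) (v : ℝ) : Prop := HasMean (fun t => inner ℝ (a t) (b t)) v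

theorem IsBdd.abs_inner_le {a b : ℤ → E} (ha : IsBdd a) (hb : IsBdd b) :
    ∃ C, ∀ t, |inner ℝ (a t) (b t)| ≤ C := by
  obtain ⟨A, hA⟩ := ha
  obtain ⟨B, hB⟩ := hb
  exact ⟨A * B, fun t => (abs_real_inner_le_norm _ _).trans
    (mul_le_mul (hA t) (hB t) (norm_nonneg _) ((norm_nonneg _).trans (hA t)))⟩

theorem MeanInner.symm {a b : ℤ → E} {v : ℝ} (h : MeanInner a b v) : MeanInner b a v := by
  simpa only [MeanInner, real_inner_comm] using h

theorem MeanInner.delay {a b : ℤ → E} {v : ℝ} (h : MeanInner a b v) (ha : IsBdd a) (hb : IsBdd b)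
    (k : ℤ) : MeanInner (fun t => a (t - k)) (fun t => b (t - k)) v :=
  HasMean.delay h (ha.abs_inner_le hb) k

theorem MeanInner.smul_right {a b : ℤ → E} {v : ℝ} (h : MeanInner a b v) (c : ℝ) :
    MeanInner a (fun t => c • b t) (c * v) := by
  simpa only [MeanInner, inner_smul_right] using h.const_mul c

theorem MeanInner.add_right {a b c : ℤ → E} {v w : ℝ} (h : MeanInner a b v) (h' : MeanInner a c w) :
    MeanInner a (fun t => b t + c t) (v + w) := by
  simpa only [MeanInner, inner_add_right] using HasMean.add h h'

theorem MeanInner.sum_right {ι : Type*} (s : Finset ι) {a : ℤ → E} {b : ι → ℤ → E} {v : ι → ℝ}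
    (h : ∀ i ∈ s, MeanInner a (b i) (v i)) :
    MeanInner a (fun t => ∑ i ∈ s, b i t) (∑ i ∈ s, v i) := by
  simpa only [MeanInner, inner_sum] using HasMean.sum s h

/-- Time average and filter sum are interchanged by dominated convergence: the k-th term is at most
|fₖ| A B, uniformly in N. The alternative in the hypothesis dispenses with the correlation at lags
where the coefficient vanishes; for a filter without direct term, lag 0 is then irrelevant. -/
theorem MeanInner.act_right [CompleteSpace E] {a b : ℤ → E} (ha : IsBdd a) (hb : IsBdd b) {f : TF}
    (hf : AbsSummable f) {r : ℕ → ℝ} (h : ∀ k : ℕ, PowerSeries.coeff k f = 0 ∨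
      MeanInner a (fun t => b (t - k)) (r k)) :
    MeanInner a (act f b) (∑' k, PowerSeries.coeff k f * r k) := by
  have key : ∀ N, avg (fun t => inner ℝ (a t) (act f b t)) N =
      ∑' k, PowerSeries.coeff k f * avg (fun t => inner ℝ (a t) (b (t - k))) N := by
    intro N
    have hs : ∀ t, Summable fun k : ℕ => PowerSeries.coeff k f * inner ℝ (a t) (b (t - k)) := by
      intro t
      simpa only [innerSL_apply_apply, inner_smul_right] using
        (innerSL ℝ (a t)).summable (act_summable hf hb t)
    have h1 : ∀ t, inner ℝ (a t) (act f b t) =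
        ∑' k : ℕ, PowerSeries.coeff k f * inner ℝ (a t) (b (t - k)) := by
      intro t
      rw [act]
      simpa only [innerSL_apply_apply, inner_smul_right] using
        (innerSL ℝ (a t)).map_tsum (act_summable hf hb t)
    simp only [avg, h1]
    rw [← Summable.tsum_finsetSum fun t _ => hs t, ← tsum_mul_left]
    refine tsum_congr fun k => ?_
    rw [← Finset.mul_sum]
    ring
  obtain ⟨A, hA⟩ := ha
  obtain ⟨B, hB⟩ := hb
  refine (tendsto_tsum_of_dominated_convergence
    (bound := fun k => |PowerSeries.coeff k f| * (A * B)) (Summable.mul_right _ hf)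
    (fun k => ?_) (Eventually.of_forall fun N k => ?_)).congr fun N => (key N).symm
  · rcases h k with h | h
    · simp [h]
    · exact Tendsto.const_mul _ h
  · rw [Real.norm_eq_abs, abs_mul]
    refine mul_le_mul_of_nonneg_left (abs_avg_le (fun t => ?_) N) (abs_nonneg _)
    exact (abs_real_inner_le_norm _ _).trans
      (mul_le_mul (hA t) (hB _) (norm_nonneg _) ((norm_nonneg _).trans (hA t)))

theorem MeanInner.act_right_zero [CompleteSpace E] {a b : ℤ → E} (ha : IsBdd a) (hb : IsBdd b)
    {f : TF} (hf : AbsSummable f) (h : ∀ k : ℕ, PowerSeries.coeff k f = 0 ∨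
      MeanInner a (fun t => b (t - k)) 0) : MeanInner a (act f b) 0 := by
  simpa using MeanInner.act_right ha hb hf (r := fun _ => 0) h

/-- All correlations between the sequences `a` and `b` exist. -/
def CorrExists (a b : ℤ → E) : Prop := ∀ τ : ℤ, ∃ v, MeanInner a (fun t => b (t - τ)) v

/-- Delaying both arguments by τ leaves the mean unchanged, so the lag merely changes sign. -/
theorem CorrExists.symm {a b : ℤ → E} (ha : IsBdd a) (hb : IsBdd b) (h : CorrExists a b) :
    CorrExists b a := by
  intro τ
  obtain ⟨v, hv⟩ := h (-τ)
  refine ⟨v, ?_⟩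
  have h := (hv.delay ha (hb.delay _) τ).symm
  simpa using h

theorem CorrExists.meanInner {a b : ℤ → E} (h : CorrExists a b) : ∃ v, MeanInner a b v := by
  simpa using h 0

theorem act_delay (f : TF) (x : ℤ → E) (τ t : ℤ) :
    act f (fun t => x (t - τ)) t = act f x (t - τ) := by
  simp only [act, sub_right_comm]

theorem CorrExists.act_right [CompleteSpace E] {a b : ℤ → E} (ha : IsBdd a) (hb : IsBdd b)
    (h : CorrExists a b) {f : TF} (hf : AbsSummable f) : CorrExists a (act f b) := by
  intro τ
  choose r hr using fun k : ℕ => h (k + τ)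
  have hr' : ∀ k : ℕ, MeanInner a (fun t => b (t - k - τ)) (r k) := by
    simpa only [sub_sub] using hr
  have h' := MeanInner.act_right ha (hb.delay τ) hf fun k => Or.inr (hr' k)
  exact ⟨_, by simpa only [MeanInner, act_delay] using h'⟩

theorem CorrExists.sum_right {ι : Type*} (s : Finset ι) {a : ℤ → E} {b : ι → ℤ → E}
    (h : ∀ i ∈ s, CorrExists a (b i)) : CorrExists a (fun t => ∑ i ∈ s, b i t) := by
  intro τ
  choose! v hv using fun i (hi : i ∈ s) => h i hi τ
  exact ⟨_, MeanInner.sum_right s hv⟩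

theorem CorrExists.mact_right [CompleteSpace E] {α β : Type*} [Fintype β] {F : Matrix α β TF}
    (hF : IsStable F) {a : ℤ → E} {x : β → ℤ → E} (ha : IsBdd a) (hx : ∀ j, IsBdd (x j))
    (h : ∀ j, CorrExists a (x j)) (i : α) : CorrExists a (mact F x i) :=
  CorrExists.sum_right _ fun j _ => (h j).act_right ha (hx j) (hF.absSummable i j)

/-- Bounded sequences of zero mean power. -/
structure IsNull (a : ℤ → E) : Prop where
  bdd : IsBdd a
  mean : MeanInner a a 0

theorem IsNull.delay {a : ℤ → E} (ha : IsNull a) (k : ℤ) : IsNull fun t => a (t - k) :=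
  ⟨ha.bdd.delay k, ha.mean.delay ha.bdd ha.bdd k⟩

/-- Pointwise, |⟪a, b⟫| ≤ ‖a‖² + ‖b‖², and the right side has mean zero. -/
theorem IsNull.meanInner {a b : ℤ → E} (ha : IsNull a) (hb : IsNull b) : MeanInner a b 0 := by
  have h := HasMean.add ha.mean hb.mean
  rw [add_zero] at h
  refine h.zero_of_abs_le fun t => ?_
  have h1 := abs_real_inner_le_norm (a t) (b t)
  rw [real_inner_self_eq_norm_sq, real_inner_self_eq_norm_sq]
  nlinarith [sq_nonneg (‖a t‖ - ‖b t‖), norm_nonneg (a t), norm_nonneg (b t),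
    mul_nonneg (norm_nonneg (a t)) (norm_nonneg (b t))]

theorem IsNull.add {a b : ℤ → E} (ha : IsNull a) (hb : IsNull b) : IsNull fun t => a t + b t := by
  refine ⟨ha.bdd.add hb.bdd, ?_⟩
  have h1 := (ha.mean.add_right (ha.meanInner hb)).symm
  have h2 := ((hb.meanInner ha).add_right hb.mean).symm
  simpa using h1.add_right h2

theorem isNull_zero : IsNull fun _ => (0 : E) :=
  ⟨isBdd_zero, by simpa [MeanInner] using hasMean_zero⟩

theorem IsNull.smul {a : ℤ → E} (ha : IsNull a) (c : ℝ) : IsNull fun t => c • a t := by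
  refine ⟨ha.bdd.smul c, ?_⟩
  simpa using ((ha.mean.smul_right c).symm).smul_right c

theorem IsNull.sum {ι : Type*} (s : Finset ι) {a : ι → ℤ → E} (h : ∀ i ∈ s, IsNull (a i)) :
    IsNull fun t => ∑ i ∈ s, a i t := by
  classical
  induction s using Finset.induction_on with
  | empty => simpa using isNull_zero
  | insert a s ha ih =>
    simp_rw [Finset.sum_insert ha]
    exact (h a (by simp)).add (ih fun i hi => h i (by simp [hi]))

theorem IsNull.act [CompleteSpace E] {a : ℤ → E} (ha : IsNull a) {f : TF} (hf : AbsSummable f) :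
    IsNull (act f a) := by
  have hb := ha.bdd.act hf
  refine ⟨hb, MeanInner.act_right_zero hb ha.bdd hf fun k => Or.inr ?_⟩
  exact (MeanInner.act_right_zero (ha.bdd.delay k) ha.bdd hf fun l =>
    Or.inr ((ha.delay k).meanInner (ha.delay l))).symm

theorem IsNull.mact [CompleteSpace E] {α β : Type*} [Fintype β] {F : Matrix α β TF}
    (hF : IsStable F) {x : β → ℤ → E} (hx : ∀ j, IsNull (x j)) (i : α) : IsNull (mact F x i) :=
  IsNull.sum _ fun j _ => (hx j).act (hF.absSummable i j)

/-- If a positive definite quadratic form in the components of `x` has zero mean, then so has every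
component. -/
theorem isNull_of_posDef {ι : Type*} [Fintype ι] {Q : Matrix ι ι ℝ} (hQ : Q.PosDef)
    {x : ι → ℤ → E} (hx : ∀ i, IsBdd (x i)) {v : ℝ}
    (h : HasMean (fun t => ∑ i, ∑ j, Q i j * inner ℝ (x i t) (x j t)) v) :
    0 ≤ v ∧ (v = 0 → ∀ i, IsNull (x i)) := by
  classical
  -- Writing Q = ∑ wₖwₖᵀ turns the form into ∑ ‖zₖ‖². Zero mean makes every zₖ null, hence also Qx,
  -- a combination of the zₖ, and finally x = Q⁻¹(Qx).
  obtain ⟨N, w, hw⟩ := Matrix.posSemidef_iff_eq_sum_vecMulVec.1 hQ.posSemidef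
  have hQij : ∀ i j, Q i j = ∑ k, w k i * w k j := fun i j => by
    rw [hw, Matrix.sum_apply]
    simp [Matrix.vecMulVec_apply]
  set z : Fin N → ℤ → E := fun k t => ∑ i, w k i • x i t with hz
  have hzb : ∀ k, IsBdd (z k) := fun k => IsBdd.sum _ fun i _ => (hx i).smul _
  have hform : (fun t => ∑ i, ∑ j, Q i j * inner ℝ (x i t) (x j t)) =
      fun t => ∑ k, inner ℝ (z k t) (z k t) := by
    funext t
    simp only [hz, sum_inner, inner_sum, real_inner_smul_left, real_inner_smul_right, hQij,
      Finset.sum_mul]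
    rw [Finset.sum_comm, Finset.sum_congr rfl fun i _ => Finset.sum_comm, Finset.sum_comm]
    refine Finset.sum_congr rfl fun k _ => Finset.sum_congr rfl fun i _ =>
      Finset.sum_congr rfl fun j _ => ?_
    ring
  rw [hform] at h
  refine ⟨h.nonneg fun t => Finset.sum_nonneg fun k _ => real_inner_self_nonneg, ?_⟩
  rintro rfl i
  have hzn : ∀ k, IsNull (z k) := fun k => ⟨hzb k, h.zero_of_abs_le fun t => by
    rw [abs_of_nonneg real_inner_self_nonneg]
    exact Finset.single_le_sum (f := fun k => inner ℝ (z k t) (z k t))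
      (fun k _ => real_inner_self_nonneg) (Finset.mem_univ k)⟩
  have hQx : ∀ j, IsNull fun t => ∑ l, Q j l • x l t := by
    intro j
    convert IsNull.sum Finset.univ fun k _ => (hzn k).smul (w k j) using 2 with t
    simp only [hz, hQij, Finset.sum_smul, Finset.smul_sum, smul_smul]
    exact Finset.sum_comm
  have hinv : Q⁻¹ * Q = 1 := Matrix.nonsing_inv_mul Q ((Matrix.isUnit_iff_isUnit_det Q).1 hQ.isUnit)
  convert IsNull.sum Finset.univ fun j _ => (hQx j).smul (Q⁻¹ i j) using 1
  funext t
  simp only [Finset.smul_sum, smul_smul]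
  rw [Finset.sum_comm]
  simp only [← Finset.sum_smul, ← Matrix.mul_apply, hinv, Matrix.one_apply, ite_smul, one_smul,
    zero_smul, Finset.sum_ite_eq, Finset.mem_univ, if_true]

end Hilbert

/-! ### Frequency responses and cross spectra -/

/-- The frequency response `∑ₖ fₖ e^{iωk}`. -/
noncomputable def freq (f : TF) (w : ℝ) : ℂ :=
  ∑' k : ℕ, ((PowerSeries.coeff k f : ℝ) : ℂ) * Complex.exp (Complex.I * w * k)

theorem norm_exp_I_mul_mul (w : ℝ) (τ : ℤ) : ‖Complex.exp (Complex.I * w * τ)‖ = 1 := by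
  have h : Complex.I * w * τ = ((w * τ : ℝ) : ℂ) * Complex.I := by
    push_cast
    ring
  rw [h, Complex.norm_exp_ofReal_mul_I]

theorem norm_freq_term (f : TF) (w : ℝ) (k : ℕ) :
    ‖((PowerSeries.coeff k f : ℝ) : ℂ) * Complex.exp (Complex.I * w * k)‖ = |PowerSeries.coeff k f| := by
  have h := norm_exp_I_mul_mul w k
  rw [Int.cast_natCast] at h
  rw [norm_mul, h, mul_one, Complex.norm_real, Real.norm_eq_abs]

theorem continuous_freq {f : TF} (hf : AbsSummable f) : Continuous (freq f) :=
  continuous_tsum (fun k => by fun_prop) hf fun k w => (norm_freq_term f w k).le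

theorem intervalIntegrable_exp_mul {φ : ℝ → ℂ} {a b : ℝ} (hφ : IntervalIntegrable φ volume a b)
    (τ : ℤ) : IntervalIntegrable (fun w : ℝ => Complex.exp (Complex.I * w * τ) * φ w) volume a b :=
  hφ.continuousOn_mul (by fun_prop)

/-- Sum and integral commute because the norms integrate to |fₖ| ∫‖φ‖, which is summable. -/
theorem integral_freq_mul {f : TF} (hf : AbsSummable f) {φ : ℝ → ℂ} {a b : ℝ} (hab : a ≤ b)
    (hφ : IntervalIntegrable φ volume a b) :
    ∫ w in a..b, freq f w * φ w =
      ∑' k : ℕ, ((PowerSeries.coeff k f : ℝ) : ℂ) *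
        ∫ w in a..b, Complex.exp (Complex.I * w * (k : ℤ)) * φ w := by
  have hterm : ∀ k : ℕ, IntervalIntegrable (fun w : ℝ => ((PowerSeries.coeff k f : ℝ) : ℂ) *
      (Complex.exp (Complex.I * w * (k : ℤ)) * φ w)) volume a b := fun k =>
    (intervalIntegrable_exp_mul hφ k).const_mul _
  have hnorm : ∀ (k : ℕ) (w : ℝ), ‖((PowerSeries.coeff k f : ℝ) : ℂ) *
      (Complex.exp (Complex.I * w * (k : ℤ)) * φ w)‖ = |PowerSeries.coeff k f| * ‖φ w‖ := by
    intro k w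
    rw [norm_mul, norm_mul, norm_exp_I_mul_mul, one_mul, Complex.norm_real, Real.norm_eq_abs]
  simp only [← intervalIntegral.integral_const_mul]
  simp only [intervalIntegral.integral_of_le hab]
  rw [integral_tsum_of_summable_integral_norm
    (fun k => (intervalIntegrable_iff_integrableOn_Ioc_of_le hab).1 (hterm k))]
  · refine integral_congr_ae (Eventually.of_forall fun w => ?_)
    simp only [freq, ← tsum_mul_right, mul_assoc, Int.cast_natCast]
  · simp only [hnorm, integral_const_mul]
    exact Summable.mul_right _ hf

/-- For k ≠ 0 the antiderivative takes equal values at ±π, as the exponents differ by 2πik. -/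
theorem integral_exp_int (k : ℤ) :
    ∫ w in (-Real.pi)..Real.pi, Complex.exp (Complex.I * w * k) =
      if k = 0 then (2 * Real.pi : ℂ) else 0 := by
  split_ifs with h
  · subst h
    simp [two_mul]
  · have hk : Complex.I * k ≠ 0 := mul_ne_zero Complex.I_ne_zero (by exact_mod_cast h)
    have e : ∀ w : ℝ, Complex.I * w * k = Complex.I * k * w := fun w => by ring
    simp only [e]
    rw [integral_exp_mul_complex hk, div_eq_zero_iff]
    left
    have e2 : Complex.I * k * (Real.pi : ℝ) =
        Complex.I * k * ((-Real.pi : ℝ) : ℂ) + k * (2 * Real.pi * Complex.I) := by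
      push_cast
      ring
    rw [e2, Complex.exp_periodic.int_mul k, sub_self]

/-- Integrating the response against e^{-iωn} isolates 2π times the n-th coefficient, by
orthogonality of the exponentials. -/
theorem eq_zero_of_freq_ae_eq_zero {f : TF} (hf : AbsSummable f)
    (h : ∀ᵐ w ∂(volume.restrict (Set.Ioc (-Real.pi) Real.pi)), freq f w = 0) : f = 0 := by
  have hpi : -Real.pi ≤ Real.pi := by linarith [Real.pi_pos]
  ext n
  have hint : IntervalIntegrable (fun w : ℝ => Complex.exp (Complex.I * w * (-n : ℤ))) volume
      (-Real.pi) Real.pi := Continuous.intervalIntegrable (by fun_prop) _ _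
  have h1 := integral_freq_mul hf hpi hint
  have h2 : ∫ w in (-Real.pi)..Real.pi,
      freq f w * Complex.exp (Complex.I * w * (-n : ℤ)) = 0 := by
    rw [intervalIntegral.integral_of_le hpi]
    refine integral_eq_zero_of_ae ?_
    filter_upwards [h] with w hw
    simp [hw]
  have h3 : ∀ k : ℕ, ∫ w in (-Real.pi)..Real.pi, Complex.exp (Complex.I * w * (k : ℤ)) *
      Complex.exp (Complex.I * w * (-n : ℤ)) = if k = n then (2 * Real.pi : ℂ) else 0 := by
    intro k
    have e : ∀ w : ℝ, Complex.exp (Complex.I * w * (k : ℤ)) *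
        Complex.exp (Complex.I * w * (-n : ℤ)) =
        Complex.exp (Complex.I * w * ((k - n : ℤ) : ℂ)) := by
      intro w
      rw [← Complex.exp_add]
      congr 1
      push_cast
      ring
    simp only [e, integral_exp_int]
    have hkn : (k : ℤ) - n = 0 ↔ k = n := by omega
    simp only [hkn]
  rw [h2] at h1
  simp only [h3] at h1
  rw [tsum_eq_single n fun k hk => by simp [hk]] at h1
  simpa [Real.pi_ne_zero] using h1.symm

section Hilbert

variable {E : Type*} [NormedAddCommGroup E] [InnerProductSpace ℝ E]

/-- The correlation function of `a` and `b` exists and consists of the Fourier coefficients of the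
integrable function `φ`. -/
structure HasCrossSpectrum (a b : ℤ → E) (φ : ℝ → ℂ) : Prop where
  integrable : IntervalIntegrable φ volume (-Real.pi) Real.pi
  corr : ∀ τ : ℤ, ∃ r : ℝ, MeanInner a (fun t => b (t - τ)) r ∧
    (r : ℂ) = (2 * Real.pi : ℂ)⁻¹ *
      ∫ w in (-Real.pi)..Real.pi, Complex.exp (Complex.I * w * τ) * φ w

/-- Exchanging the signals negates the lag; since correlations are real, conjugating the Fourier
formula restores the sign of the exponent. -/
theorem HasCrossSpectrum.symm {a b : ℤ → E} (ha : IsBdd a) (hb : IsBdd b) {φ : ℝ → ℂ}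
    (h : HasCrossSpectrum a b φ) : HasCrossSpectrum b a fun w => star (φ w) := by
  have hpi : -Real.pi ≤ Real.pi := by linarith [Real.pi_pos]
  refine ⟨?_, fun τ => ?_⟩
  · exact ⟨Complex.conjCLE.toContinuousLinearMap.integrable_comp h.integrable.1,
      Complex.conjCLE.toContinuousLinearMap.integrable_comp h.integrable.2⟩
  · obtain ⟨r, hr, e⟩ := h.corr (-τ)
    refine ⟨r, by simpa using (hr.delay ha (hb.delay _) τ).symm, ?_⟩
    have e' := congrArg (starRingEnd ℂ) e
    rw [Complex.conj_ofReal] at e'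
    rw [e', map_mul, map_inv₀, map_mul, Complex.conj_ofReal, Complex.conj_ofNat,
      intervalIntegral.integral_of_le hpi, ← integral_conj,
      ← intervalIntegral.integral_of_le hpi]
    congr 1
    refine intervalIntegral.integral_congr fun w _ => ?_
    simp only [map_mul, ← Complex.exp_conj, Complex.conj_I, Complex.conj_ofReal, map_intCast]
    congr 2
    push_cast
    ring

theorem HasCrossSpectrum.sum_right {ι : Type*} (s : Finset ι) {a : ℤ → E} {b : ι → ℤ → E}
    {φ : ι → ℝ → ℂ} (h : ∀ i ∈ s, HasCrossSpectrum a (b i) (φ i)) :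
    HasCrossSpectrum a (fun t => ∑ i ∈ s, b i t) fun w => ∑ i ∈ s, φ i w := by
  refine ⟨?_, fun τ => ?_⟩
  · have := IntervalIntegrable.sum s fun i hi => (h i hi).integrable
    simpa only [Finset.sum_fn] using this
  · choose! r hr e using fun i (hi : i ∈ s) => (h i hi).corr τ
    refine ⟨_, MeanInner.sum_right s hr, ?_⟩
    simp only [Finset.mul_sum]
    rw [intervalIntegral.integral_finsetSum fun i hi =>
      intervalIntegrable_exp_mul (h i hi).integrable τ, Finset.mul_sum, Complex.ofReal_sum]
    exact Finset.sum_congr rfl e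

variable [CompleteSpace E]

/-- The new correlation at lag τ is ∑ₖ fₖ r(k + τ). The advance by k multiplies the integrand by
e^{iωk}, which is why `freq` carries the positive exponent. -/
theorem HasCrossSpectrum.act_right {a b : ℤ → E} (ha : IsBdd a) (hb : IsBdd b) {φ : ℝ → ℂ}
    (h : HasCrossSpectrum a b φ) {f : TF} (hf : AbsSummable f) :
    HasCrossSpectrum a (act f b) fun w => freq f w * φ w := by
  have hpi : -Real.pi ≤ Real.pi := by linarith [Real.pi_pos]
  refine ⟨h.integrable.continuousOn_mul (continuous_freq hf).continuousOn, fun τ => ?_⟩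
  choose r hr e using fun k : ℕ => h.corr (k + τ)
  have hr' : ∀ k : ℕ, MeanInner a (fun t => b (t - k - τ)) (r k) := by
    simpa only [sub_sub] using hr
  have h' := MeanInner.act_right ha (hb.delay τ) hf fun k => Or.inr (hr' k)
  refine ⟨_, by simpa only [MeanInner, act_delay] using h', ?_⟩
  have e1 : ∀ w : ℝ, Complex.exp (Complex.I * w * τ) * (freq f w * φ w) =
      freq f w * (Complex.exp (Complex.I * w * τ) * φ w) := fun w => by ring
  have e2 : ∀ (k : ℕ) (w : ℝ), Complex.exp (Complex.I * w * ((k + τ : ℤ) : ℂ)) * φ w =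
      Complex.exp (Complex.I * w * (k : ℤ)) * (Complex.exp (Complex.I * w * τ) * φ w) := by
    intro k w
    rw [← mul_assoc, ← Complex.exp_add]
    congr 2
    push_cast
    ring
  simp only [e1]
  rw [integral_freq_mul hf hpi (intervalIntegrable_exp_mul h.integrable τ), ← tsum_mul_left,
    Complex.ofReal_tsum]
  refine tsum_congr fun k => ?_
  rw [Complex.ofReal_mul, e k, mul_left_comm]
  simp only [e2]

/-- A linear combination of filtered signals with almost everywhere positive definite spectrum has
zero mean power only if all filters vanish. -/
theorem eq_zero_of_isNull {ι : Type*} [Fintype ι] {x : ι → ℤ → E} (hx : ∀ i, IsBdd (x i))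
    {Φ : ℝ → Matrix ι ι ℂ} (hΦ : ∀ i j, HasCrossSpectrum (x i) (x j) fun w => Φ w i j)
    (hpos : PosDefAE Φ) {d : ι → TF} (hd : ∀ i, AbsSummable (d i))
    (hnull : IsNull fun t => ∑ i, act (d i) (x i) t) : d = 0 := by
  have hpi : -Real.pi ≤ Real.pi := by linarith [Real.pi_pos]
  have h1 : ∀ i, HasCrossSpectrum (x i) (fun t => ∑ i, act (d i) (x i) t)
      fun w => ∑ j, freq (d j) w * Φ w i j := fun i =>
    HasCrossSpectrum.sum_right _ fun j _ => (hΦ i j).act_right (hx i) (hx j) (hd j)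
  -- Filtering the other argument as well gives the spectrum of the combination itself: the
  -- conjugate of the quadratic form of Φ at the frequency responses.
  have h2 := HasCrossSpectrum.sum_right Finset.univ fun i _ =>
    ((h1 i).symm (hx i) hnull.bdd).act_right hnull.bdd (hx i) (hd i)
  obtain ⟨r, hr, e⟩ := h2.corr 0
  simp only [sub_zero] at hr
  have hr0 : r = 0 := tendsto_nhds_unique hr hnull.mean
  set D : ℝ → ι → ℂ := fun w i => freq (d i) w with hD
  set q : ℝ → ℂ := fun w => ∑ i, freq (d i) w * star (∑ j, freq (d j) w * Φ w i j) with hq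
  have hqD : ∀ w, q w = star (star (D w) ⬝ᵥ Φ w *ᵥ D w) := by
    intro w
    simp only [hq, hD, dotProduct, Matrix.mulVec, star_sum, star_mul', Pi.star_apply, star_star,
      mul_comm]
  have hint : IntegrableOn q (Set.Ioc (-Real.pi) Real.pi) :=
    (intervalIntegrable_iff_integrableOn_Ioc_of_le hpi).1 h2.integrable
  have hq0 : ∫ w in Set.Ioc (-Real.pi) Real.pi, q w = 0 := by
    rw [hr0, intervalIntegral.integral_of_le hpi] at e
    have e' := e.symm
    simp only [Int.cast_zero, mul_zero, Complex.exp_zero, one_mul, Complex.ofReal_zero] at e'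
    exact (mul_eq_zero.1 e').resolve_left (by simp [Real.pi_ne_zero])
  have hre : ∫ w in Set.Ioc (-Real.pi) Real.pi, (q w).re = 0 := by
    have := integral_re (𝕜 := ℂ) hint
    simpa [hq0] using this
  have hnn : 0 ≤ᵐ[volume.restrict (Set.Ioc (-Real.pi) Real.pi)] fun w => (q w).re := by
    filter_upwards [hpos] with w hw
    have := hw.posSemidef.dotProduct_mulVec_nonneg (D w)
    simpa [hqD] using (Complex.le_def.1 this).1
  -- The mean power is the lag-0 correlation, so a nonnegative function with zero integral appears
  -- and must vanish almost everywhere.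
  have hae := (integral_eq_zero_iff_of_nonneg_ae hnn hint.re).1 hre
  funext i
  refine eq_zero_of_freq_ae_eq_zero (hd i) ?_
  filter_upwards [hpos, hae] with w hw hw0
  by_contra hne
  have hDw : D w ≠ 0 := fun h => hne (congrFun h i)
  have := (Complex.lt_def.1 (hw.dotProduct_mulVec_pos hDw)).1
  have h0 : (star (D w) ⬝ᵥ Φ w *ᵥ D w).re = 0 := by simpa [hqD] using hw0
  rw [h0] at this
  exact lt_irrefl _ this

end Hilbert

/-! ### Signals as sequences in `L²` -/

section Bridge

variable {Ω : Type*} [MeasurableSpace Ω] {P : Measure Ω} {α β : Type*}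

/-- The components of the signal `s` are almost surely equal to the sequences `X` in `L²`. -/
def Represents (P : Measure Ω) (s : Signal Ω α) (X : α → ℤ → Lp ℝ 2 P) : Prop :=
  ∀ t i, ∀ᵐ ω ∂P, s t ω i = X i t ω

/-- Absolute convergence in L² also gives almost sure pointwise convergence to the same sum, so the
pathwise filter agrees with the Hilbert space one. -/
theorem Represents.filt [Fintype β] {F : Matrix α β TF} (hF : IsStable F) {s : Signal Ω β}
    {X : β → ℤ → Lp ℝ 2 P} (hs : Represents P s X) (hX : ∀ j, IsBdd (X j)) :
    Represents P (filt F s) (mact F X) := by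
  intro t i
  have hterm : ∀ j, ∀ᵐ ω ∂P,
      ∑' k : ℕ, PowerSeries.coeff k (F i j) * s (t - k) ω j = act (F i j) (X j) t ω := by
    intro j
    have hsum : ∑' k : ℕ, ‖PowerSeries.coeff k (F i j) • X j (t - k)‖ₑ ≠ ⊤ :=
      tsum_enorm_ne_top_iff_summable_norm.2 (act_summable_norm (hF.absSummable i j) (hX j) t)
    filter_upwards [Lp.hasSum_coeFn_tsum hsum, ae_all_iff.2 fun k : ℕ => hs (t - k) j,
      ae_all_iff.2 fun k : ℕ => Lp.coeFn_smul (PowerSeries.coeff k (F i j)) (X j (t - k))]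
      with ω h1 h2 h3
    rw [act, ← h1.tsum_eq]
    refine tsum_congr fun k => ?_
    rw [h2 k, h3 k, Pi.smul_apply, smul_eq_mul]
  filter_upwards [ae_all_iff.2 hterm,
    Lp.coeFn_fun_finsetSum Finset.univ fun j => act (F i j) (X j) t] with ω h1 h2
  rw [mact, h2, PredErr.filt]
  exact Finset.sum_congr rfl fun j _ => h1 j

theorem Represents.sub {s s' : Signal Ω α} {X X' : α → ℤ → Lp ℝ 2 P} (hs : Represents P s X)
    (hs' : Represents P s' X') :
    Represents P (fun t ω => s t ω - s' t ω) fun i t => X i t - X' i t := by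
  intro t i
  filter_upwards [hs t i, hs' t i, Lp.coeFn_sub (X i t) (X' i t)] with ω h1 h2 h3
  rw [h3, Pi.sub_apply, Pi.sub_apply, h1, h2]

theorem Represents.mul_ae_eq {s : Signal Ω α} {s' : Signal Ω β} {X : α → ℤ → Lp ℝ 2 P}
    {X' : β → ℤ → Lp ℝ 2 P} (hs : Represents P s X) (hs' : Represents P s' X') (t t' : ℤ)
    (i : α) (j : β) :
    (fun ω => inner ℝ (X i t ω) (X' j t' ω)) =ᵐ[P] fun ω => s t ω i * s' t' ω j := by
  filter_upwards [hs t i, hs' t' j] with ω h1 h2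
  rw [h1, h2, real_inner_comm]
  rfl

theorem Represents.integrable_mul {s : Signal Ω α} {s' : Signal Ω β} {X : α → ℤ → Lp ℝ 2 P}
    {X' : β → ℤ → Lp ℝ 2 P} (hs : Represents P s X) (hs' : Represents P s' X') (t t' : ℤ)
    (i : α) (j : β) : Integrable (fun ω => s t ω i * s' t' ω j) P :=
  (L2.integrable_inner (𝕜 := ℝ) (X i t) (X' j t')).congr (hs.mul_ae_eq hs' t t' i j)

theorem Represents.integral_mul {s : Signal Ω α} {s' : Signal Ω β} {X : α → ℤ → Lp ℝ 2 P}
    {X' : β → ℤ → Lp ℝ 2 P} (hs : Represents P s X) (hs' : Represents P s' X') (t t' : ℤ)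
    (i : α) (j : β) : ∫ ω, s t ω i * s' t' ω j ∂P = inner ℝ (X i t) (X' j t') := by
  rw [L2.inner_def]
  exact (integral_congr_ae (hs.mul_ae_eq hs' t t' i j)).symm

theorem HasGenExp.meanInner {s : Signal Ω α} {s' : Signal Ω β} {X : α → ℤ → Lp ℝ 2 P}
    {X' : β → ℤ → Lp ℝ 2 P} (hs : Represents P s X) (hs' : Represents P s' X') {τ : ℤ}
    {i : α} {j : β} {v : ℝ} (h : HasGenExp P (fun t ω => s t ω i * s' (t - τ) ω j) v) :
    MeanInner (X i) (fun t => X' j (t - τ)) v := by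
  have h2 := h.2
  simp only [hs.integral_mul hs'] at h2
  exact h2

theorem Represents.hasGenExp_form [Fintype α] {s : Signal Ω α} {X : α → ℤ → Lp ℝ 2 P}
    (hs : Represents P s X) (Q : Matrix α α ℝ) {v : ℝ}
    (h : HasMean (fun t => ∑ i, ∑ j, Q i j * inner ℝ (X i t) (X j t)) v) :
    HasGenExp P (fun t ω => s t ω ⬝ᵥ Q *ᵥ s t ω) v := by
  have e : ∀ t ω, s t ω ⬝ᵥ Q *ᵥ s t ω = ∑ i, ∑ j, Q i j * (s t ω i * s t ω j) := by
    intro t ω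
    simp only [dotProduct, Matrix.mulVec, Finset.mul_sum]
    exact Finset.sum_congr rfl fun i _ => Finset.sum_congr rfl fun j _ => by ring
  have hint : ∀ t i j, Integrable (fun ω => Q i j * (s t ω i * s t ω j)) P := fun t i j =>
    (hs.integrable_mul hs t t i j).const_mul _
  have hint' : ∀ t i, Integrable (fun ω => ∑ j, Q i j * (s t ω i * s t ω j)) P := fun t i =>
    integrable_finsetSum _ fun j _ => hint t i j
  simp only [HasGenExp, e]
  refine ⟨fun t => integrable_finsetSum _ fun i _ => hint' t i, h.congr fun N => ?_⟩
  rw [avg]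
  congr 1
  refine Finset.sum_congr rfl fun t _ => ?_
  rw [integral_finsetSum _ fun i _ => hint' t i]
  refine Finset.sum_congr rfl fun i _ => ?_
  rw [integral_finsetSum _ fun j _ => hint t i j]
  refine Finset.sum_congr rfl fun j _ => ?_
  rw [integral_const_mul, hs.integral_mul hs]

theorem IsQuasiStationary.exists_represents {s : Signal Ω α} (h : IsQuasiStationary P s) :
    ∃ X : α → ℤ → Lp ℝ 2 P, Represents P s X ∧ ∀ i, IsBdd (X i) := by
  obtain ⟨C, hC⟩ := h.bounded
  have hrep : Represents P s fun i t => (h.memLp t i).toLp _ := fun t i =>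
    (h.memLp t i).coeFn_toLp.symm
  refine ⟨_, hrep, fun i => ⟨√C, fun t => Real.le_sqrt_of_sq_le ?_⟩⟩
  rw [← real_inner_self_eq_norm_sq, ← hrep.integral_mul hrep t t i i]
  simpa only [sq] using hC t i

end Bridge

theorem filt_stack {Ω α β ι : Type*} [Fintype α] [Fintype β] (F : Matrix ι α TF) (K : Matrix ι β TF)
    (s : Signal Ω α) (s' : Signal Ω β) (t : ℤ) (ω : Ω) :
    filt (Matrix.fromCols F K) (stack s s') t ω = filt F s t ω + filt K s' t ω := by
  funext i
  simp [filt, stack, Fintype.sum_sum_type]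

/-! ### The prediction error -/

theorem IsAdmissible.isUnit_det {p m : ℕ} {G : Matrix (Fin p) (Fin m) TF}
    {H : Matrix (Fin p) (Fin p) TF} (h : IsAdmissible G H) : IsUnit H.det := by
  rw [PowerSeries.isUnit_iff_constantCoeff, RingHom.map_det, RingHom.mapMatrix_apply, h.monic_H]
  simp

theorem IsAdmissible.isStable_combined {p m : ℕ} {G : Matrix (Fin p) (Fin m) TF}
    {H : Matrix (Fin p) (Fin p) TF} (h : IsAdmissible G H) : IsStable (combined G H) :=
  h.stable_G.fromCols h.stable_H

section PredictionError

variable {Ω : Type*} [MeasurableSpace Ω] {P : Measure Ω} {p m : ℕ}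
  {G0 G : Matrix (Fin p) (Fin m) TF} {H0 H : Matrix (Fin p) (Fin p) TF}

/-- The filter `H⁻¹ (M⁰ - M)` from `κ` to the difference of prediction error and noise. -/
noncomputable def mismatch (G0 G : Matrix (Fin p) (Fin m) TF) (H0 H : Matrix (Fin p) (Fin p) TF) :
    Matrix (Fin p) (Fin m ⊕ Fin p) TF :=
  H⁻¹ * (combined G0 H0 - combined G H)

theorem isStable_mismatch (h0 : IsAdmissible G0 H0) (h : IsAdmissible G H) :
    IsStable (mismatch G0 G H0 H) :=
  h.stable_H_inv.mul (h0.isStable_combined.sub h.isStable_combined)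

theorem mul_mismatch (h : IsAdmissible G H) :
    H * mismatch G0 G H0 H = combined G0 H0 - combined G H := by
  rw [mismatch, ← Matrix.mul_assoc, Matrix.mul_nonsing_inv _ h.isUnit_det, Matrix.one_mul]

/-- Monicity gives H⁰ and H equal constant terms, and left multiplication by the causal H⁻¹ creates
no direct term. -/
theorem coeff_zero_mismatch_inr (h0 : IsAdmissible G0 H0) (h : IsAdmissible G H) (i j : Fin p) :
    PowerSeries.coeff 0 (mismatch G0 G H0 H i (Sum.inr j)) = 0 := by
  have hcc : ∀ l, PowerSeries.constantCoeff (H0 l j) = PowerSeries.constantCoeff (H l j) :=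
    fun l => congrFun (congrFun (h0.monic_H.trans h.monic_H.symm) l) j
  simp [mismatch, Matrix.mul_apply, hcc]

/-- The filter from `κ = (u, e)` to the data `z = (y, u)`. -/
noncomputable def dataFilter (G0 : Matrix (Fin p) (Fin m) TF) (H0 : Matrix (Fin p) (Fin p) TF) :
    Matrix (Fin p ⊕ Fin m) (Fin m ⊕ Fin p) TF :=
  Matrix.fromRows (combined G0 H0) (Matrix.fromCols 1 0)

theorem combined_sub_predictorFilter_mul (h : IsAdmissible G H) :
    combined G0 H0 - predictorFilter G H * dataFilter G0 H0 =
      Matrix.fromCols 0 1 + mismatch G0 G H0 H := by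
  have hH : H⁻¹ * H = 1 := Matrix.nonsing_inv_mul _ h.isUnit_det
  have h1 : Matrix.fromCols (H⁻¹ * G) 0 = H⁻¹ * combined G H - Matrix.fromCols 0 1 := by
    rw [combined, Matrix.mul_fromCols, hH]
    ext i (j | j) <;> simp
  rw [predictorFilter, dataFilter, Matrix.fromCols_mul_fromRows, Matrix.mul_fromCols (H⁻¹ * G), Matrix.mul_one,
    Matrix.mul_zero, h1, mismatch, Matrix.sub_mul, Matrix.mul_sub, Matrix.one_mul]
  abel

theorem mact_fromCols_zero_one {E : Type*} [NormedAddCommGroup E] [InnerProductSpace ℝ E]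
    {α β : Type*} [Fintype α] [Fintype β] [DecidableEq β] (x : α ⊕ β → ℤ → E) (i : β) :
    mact (Matrix.fromCols (0 : Matrix β α TF) (1 : Matrix β β TF)) x i = x (Sum.inr i) := by
  funext t
  simp only [mact, Fintype.sum_sum_type, Matrix.fromCols_apply_inl, Matrix.fromCols_apply_inr,
    Matrix.zero_apply, act_zero_left, Finset.sum_const_zero, zero_add]
  rw [Finset.sum_eq_single i]
  · simp
  · intro j _ hj
    simp [Matrix.one_apply_ne hj.symm]
  · simp

theorem mact_fromCols_one_zero {E : Type*} [NormedAddCommGroup E] [InnerProductSpace ℝ E]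
    {α β : Type*} [Fintype α] [Fintype β] [DecidableEq α] (x : α ⊕ β → ℤ → E) (i : α) :
    mact (Matrix.fromCols (1 : Matrix α α TF) (0 : Matrix α β TF)) x i = x (Sum.inl i) := by
  funext t
  simp only [mact, Fintype.sum_sum_type, Matrix.fromCols_apply_inl, Matrix.fromCols_apply_inr,
    Matrix.zero_apply, act_zero_left, Finset.sum_const_zero, add_zero]
  rw [Finset.sum_eq_single i]
  · simp
  · intro j _ hj
    simp [Matrix.one_apply_ne hj.symm]
  · simp

/-- This is ε = e + Dκ, read in L². -/
theorem represents_predictionError (h0 : IsAdmissible G0 H0) (h : IsAdmissible G H)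
    {u : Signal Ω (Fin m)} {e y : Signal Ω (Fin p)}
    (hy : ∀ t, ∀ᵐ ω ∂P, y t ω = filt G0 u t ω + filt H0 e t ω)
    {K : Fin m ⊕ Fin p → ℤ → Lp ℝ 2 P} (hK : Represents P (stack u e) K)
    (hb : ∀ j, IsBdd (K j)) :
    Represents P (predictionError G H y u)
      fun i t => K (Sum.inr i) t + mact (mismatch G0 G H0 H) K i t := by
  set T := dataFilter G0 H0
  have hTs : IsStable T :=
    h0.isStable_combined.fromRows (isStable_one.fromCols isStable_zero)
  have hWs : IsStable (predictorFilter G H) :=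
    (isStable_one.sub h.stable_H_inv).fromCols (h.stable_H_inv.mul h.stable_G)
  have hyY : Represents P y (mact (combined G0 H0) K) := by
    intro t i
    filter_upwards [hy t, hK.filt h0.isStable_combined hb t i] with ω h1 h2
    rw [h1, ← h2, combined, filt_stack]
  have hz : Represents P (stack y u) (mact T K) := by
    rintro t (i | i)
    · exact hyY t i
    · have e1 : mact T K (Sum.inr i) = K (Sum.inl i) := mact_fromCols_one_zero K i
      rw [e1]
      exact hK t (Sum.inl i)
  have hε := hyY.sub (hz.filt hWs fun j => IsBdd.mact hTs hb j)
  have hsum : ∀ i t, K (Sum.inr i) t + mact (mismatch G0 G H0 H) K i t =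
      mact (combined G0 H0) K i t - mact (predictorFilter G H) (mact T K) i t := by
    intro i t
    have hM : IsStable (Matrix.fromCols 0 1 + mismatch G0 G H0 H) := by
      rw [← combined_sub_predictorFilter_mul h]
      exact h0.isStable_combined.sub (hWs.mul hTs)
    -- Applied to ([0 I] + D) - D = [0 I], which extracts e from κ.
    have h1 := mact_sub hM (isStable_mismatch h0 h) hb i t
    rw [add_sub_cancel_right, mact_fromCols_zero_one] at h1
    rw [h1, sub_add_cancel, ← combined_sub_predictorFilter_mul h, ← mact_mul hWs hTs hb,
      mact_sub h0.isStable_combined (hWs.mul hTs) hb]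
  simp only [hsum]
  exact hε

end PredictionError

theorem cost_decomposition {E : Type*} [NormedAddCommGroup E] [InnerProductSpace ℝ E]
    {ι : Type*} [Fintype ι] {Q : Matrix ι ι ℝ} {x w : ι → ℤ → E} {c q : ℝ}
    (hc : HasMean (fun t => ∑ i, ∑ j, Q i j * inner ℝ (x i t) (x j t)) c)
    (hq : HasMean (fun t => ∑ i, ∑ j, Q i j * inner ℝ (w i t) (w j t)) q)
    (hxw : ∀ i j, MeanInner (x i) (w j) 0) :
    HasMean (fun t => ∑ i, ∑ j, Q i j * inner ℝ (x i t + w i t) (x j t + w j t)) (c + q) := by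
  have h1 : HasMean (fun t => ∑ i, ∑ j, Q i j * (inner ℝ (x i t) (w j t) +
      inner ℝ (w i t) (x j t))) (∑ i, ∑ j, Q i j * (0 + 0)) :=
    HasMean.sum _ fun i _ => HasMean.sum _ fun j _ =>
      HasMean.const_mul _ (HasMean.add (hxw i j) (hxw j i).symm)
  have h := (hc.add h1).add hq
  simp only [add_zero, mul_zero, Finset.sum_const_zero] at h
  convert h using 2 with t
  simp only [← Finset.sum_add_distrib]
  refine Finset.sum_congr rfl fun i _ => Finset.sum_congr rfl fun j _ => ?_
  rw [inner_add_left, inner_add_right, inner_add_right]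
  ring

/-- If a row filter supported in `S` annihilates the mean power of the signal and the components in
`S` have a spectrum that is positive definite almost everywhere, then the row filter vanishes. -/
theorem eq_zero_of_isNull_of_support {Ω : Type*} [MeasurableSpace Ω] {P : Measure Ω} {κ : Type*}
    [Fintype κ] {s : Signal Ω κ} {K : κ → ℤ → Lp ℝ 2 P} (hK : Represents P s K)
    (hb : ∀ j, IsBdd (K j)) {S : Set κ} {Φ : ℝ → Matrix S S ℂ}
    (hΦ : IsSpectrum P (subSignal s S) Φ) (hpos : PosDefAE Φ) {d : κ → TF}
    (hd : ∀ j, AbsSummable (d j)) (hS : ∀ j, j ∉ S → d j = 0)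
    (hnull : IsNull fun t => ∑ j, act (d j) (K j) t) : d = 0 := by
  classical
  obtain ⟨hint, R, hR, hRΦ⟩ := hΦ
  have hKS : Represents P (subSignal s S) fun j : S => K j := fun t j => hK t j
  have hcs : ∀ i j : S, HasCrossSpectrum (K i) (K j) fun w => Φ w i j := fun i j =>
    ⟨hint i j, fun τ => ⟨R τ i j, (hR τ i j).meanInner hKS hKS, hRΦ τ i j⟩⟩
  have hsum : ∀ t, ∑ j, act (d j) (K j) t = ∑ j : S, act (d j) (K j) t := by
    intro t
    rw [← Finset.sum_filter_of_ne (p := fun j => j ∈ S)]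
    · exact Finset.sum_subtype _ (by simp) _
    · intro j _ hj
      by_contra hjS
      simp [hS j hjS] at hj
  simp only [hsum] at hnull
  have hz := eq_zero_of_isNull (fun j : S => hb j) hcs hpos (fun j : S => hd j) hnull
  funext j
  by_cases hj : j ∈ S
  · exact congrFun hz ⟨j, hj⟩
  · exact hS j hj

end PredErr

/-! ### Minimizers of the cost -/

theorem proposition1 {Ω : Type*} [MeasurableSpace Ω] (P : MeasureTheory.Measure Ω)
    [MeasureTheory.IsProbabilityMeasure P] {p m n : ℕ}
    -- the data generating system `y = G⁰ u + H⁰ e`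
    (G0 : Matrix (Fin p) (Fin m) PredErr.TF) (H0 : Matrix (Fin p) (Fin p) PredErr.TF)
    (h0 : PredErr.IsAdmissible G0 H0)
    (u : PredErr.Signal Ω (Fin m)) (e y : PredErr.Signal Ω (Fin p))
    (hqs : PredErr.IsQuasiStationary P (PredErr.stack u e))
    (hwhite : PredErr.IsWhite P e)
    (hue : PredErr.IsUncorrelatedWithPast P e u)
    (hy : ∀ t, ∀ᵐ ω ∂P, y t ω = PredErr.filt G0 u t ω + PredErr.filt H0 e t ω)
    -- the parametrized model set, containing the system
    (Θ : Set (Fin n → ℝ))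
    (G : (Fin n → ℝ) → Matrix (Fin p) (Fin m) PredErr.TF)
    (H : (Fin n → ℝ) → Matrix (Fin p) (Fin p) PredErr.TF)
    (hmodel : ∀ θ ∈ Θ, PredErr.IsAdmissible (G θ) (H θ))
    (hsys : ∃ θ₀ ∈ Θ, PredErr.combined (G θ₀) (H θ₀) = PredErr.combined G0 H0)
    (hrows : PredErr.IndependentRows Θ fun θ => PredErr.combined (G θ) (H θ))
    -- the weighting matrix of the cost function
    (Q : Matrix (Fin p) (Fin p) ℝ) (hQ : Q.PosDef)
    -- the spectra of the signals entering the nonzero entries of each row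
    (Φ : (ℓ : Fin p) → ℝ →
      Matrix (PredErr.rowSupport Θ (fun θ => PredErr.combined (G θ) (H θ)) ℓ)
        (PredErr.rowSupport Θ (fun θ => PredErr.combined (G θ) (H θ)) ℓ) ℂ)
    (hΦ : ∀ ℓ, PredErr.IsSpectrum P
      (PredErr.subSignal (PredErr.stack u e)
        (PredErr.rowSupport Θ (fun θ => PredErr.combined (G θ) (H θ)) ℓ)) (Φ ℓ))
    (hpos : ∀ ℓ, PredErr.PosDefAE (Φ ℓ)) :
    ∃ V : (Fin n → ℝ) → ℝ,
      (∀ θ ∈ Θ, PredErr.HasGenExp P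
        (fun t ω => PredErr.predictionError (G θ) (H θ) y u t ω ⬝ᵥ
          Q *ᵥ PredErr.predictionError (G θ) (H θ) y u t ω) (V θ)) ∧
      ∀ θ ∈ Θ, IsMinOn V Θ θ ↔
        PredErr.combined (G θ) (H θ) = PredErr.combined G0 H0 := by
  classical
  obtain ⟨θ₀, hθ₀, hM0⟩ := hsys
  obtain ⟨K, hK, hb⟩ := hqs.exists_represents
  obtain ⟨R, hR⟩ := hqs.correlation
  have hcorr : ∀ i j, PredErr.CorrExists (K i) (K j) := fun i j τ =>
    ⟨_, (hR τ i j).meanInner hK hK⟩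
  have hKu : PredErr.Represents P u fun j => K (Sum.inl j) := fun t j => hK t (Sum.inl j)
  have hKe : PredErr.Represents P e fun j => K (Sum.inr j) := fun t j => hK t (Sum.inr j)
  choose c₂ hc₂ using fun i j : Fin p => (hcorr (Sum.inr i) (Sum.inr j)).meanInner
  have hc := PredErr.HasMean.sum Finset.univ fun i _ =>
    PredErr.HasMean.sum Finset.univ fun j _ => PredErr.HasMean.const_mul (Q i j) (hc₂ i j)
  -- The noise floor Ē eᵀQe, which will be the minimum of the cost.
  set c : ℝ := ∑ i, ∑ j, Q i j * c₂ i j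
  have key : ∀ θ ∈ Θ, ∃ v : ℝ, PredErr.HasGenExp P
      (fun t ω => PredErr.predictionError (G θ) (H θ) y u t ω ⬝ᵥ
        Q *ᵥ PredErr.predictionError (G θ) (H θ) y u t ω) v ∧ c ≤ v ∧
      (v = c ↔ PredErr.combined (G θ) (H θ) = PredErr.combined G0 H0) := by
    intro θ hθ
    have hadm := hmodel θ hθ
    set D := PredErr.mismatch G0 (G θ) H0 (H θ) with hD
    have hDs : PredErr.IsStable D := PredErr.isStable_mismatch h0 hadm
    have hwb : ∀ i, PredErr.IsBdd (PredErr.mact D K i) := PredErr.IsBdd.mact hDs hb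
    have hwcorr : ∀ i j, PredErr.CorrExists (PredErr.mact D K i) (PredErr.mact D K j) :=
      fun i => PredErr.CorrExists.mact_right hDs (hwb i) hb fun j =>
        (PredErr.CorrExists.mact_right hDs (hb j) hb (hcorr j) i).symm (hb j) (hwb i)
    choose q₂ hq₂ using fun i j => (hwcorr i j).meanInner
    have hq := PredErr.HasMean.sum Finset.univ fun i _ =>
      PredErr.HasMean.sum Finset.univ fun j _ => PredErr.HasMean.const_mul (Q i j) (hq₂ i j)
    set q : ℝ := ∑ i, ∑ j, Q i j * q₂ i j
    have hcross : ∀ i j, PredErr.MeanInner (K (Sum.inr i)) (PredErr.mact D K j) 0 := by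
      intro i j
      have h := PredErr.MeanInner.sum_right Finset.univ (a := K (Sum.inr i))
        (b := fun l => PredErr.act (D j l) (K l)) (v := fun _ => 0) fun l _ =>
          PredErr.MeanInner.act_right_zero (hb _) (hb l) (hDs.absSummable j l) fun k => ?_
      · simp only [Finset.sum_const_zero] at h
        exact h
      -- Inputs are uncorrelated with e at every lag k ≥ 0. Whiteness covers the noise only for k ≥
      -- 1; at k = 0 the filter coefficient vanishes instead.
      · rcases l with l | l
        · exact Or.inr ((hue k (by positivity) i l).meanInner hKe hKu)
        · rcases Nat.eq_zero_or_pos k with rfl | hk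
          · exact Or.inl (PredErr.coeff_zero_mismatch_inr h0 hadm j l)
          · exact Or.inr ((hwhite k (by omega) i l).meanInner hKe hKe)
    have hmean := PredErr.cost_decomposition hc hq hcross
    obtain ⟨hq0, hqnull⟩ := PredErr.isNull_of_posDef hQ hwb hq
    refine ⟨c + q, (PredErr.represents_predictionError h0 hadm hy hK hb).hasGenExp_form Q hmean,
      by linarith, fun hv => ?_, fun hM => ?_⟩
    · have hw := hqnull (by linarith)
      have hdiff : PredErr.combined G0 H0 - PredErr.combined (G θ) (H θ) = 0 := by
        funext ℓ
        refine PredErr.eq_zero_of_isNull_of_support hK hb (hΦ ℓ) (hpos ℓ)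
          (fun j => (h0.isStable_combined.sub hadm.isStable_combined).absSummable ℓ j)
          (fun j hj => ?_) ?_
        -- M⁰ belongs to the model set, so its structural zeros include those of the set.
        · have hz : ∀ θ' ∈ Θ, PredErr.combined (G θ') (H θ') ℓ j = 0 := fun θ' hθ' => by
            by_contra hne
            exact hj ⟨θ', hθ', hne⟩
          rw [← hM0, Matrix.sub_apply, hz θ₀ hθ₀, hz θ hθ, sub_zero]
        -- Filtering w by H undoes the H⁻¹ in D and leaves (M⁰ - M) κ, whose rows have the
        -- structural zeros that D may lack.
        · have h := PredErr.IsNull.mact hadm.stable_H hw ℓ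
          rw [← PredErr.mact_mul hadm.stable_H hDs hb, hD, PredErr.mul_mismatch hadm] at h
          exact h
      exact (sub_eq_zero.1 hdiff).symm
    · have hD0 : D = 0 := by
        rw [hD, PredErr.mismatch, hM, sub_self, Matrix.mul_zero]
      have hw0 : ∀ i t, PredErr.mact D K i t = 0 := fun i t => by simp [PredErr.mact, hD0]
      simp only [hw0, inner_zero_left, mul_zero, Finset.sum_const_zero] at hq
      rw [tendsto_nhds_unique hq PredErr.hasMean_zero, add_zero]
  choose! V hV hcV hVc using key
  refine ⟨V, hV, fun θ hθ => ⟨fun hmin => ?_, fun hM θ' hθ' => ?_⟩⟩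
  -- The lower bound c is attained at θ₀, so a minimizer has cost exactly c.
  · have h1 : V θ ≤ V θ₀ := hmin hθ₀
    rw [(hVc θ₀ hθ₀).2 hM0] at h1
    exact (hVc θ hθ).1 (le_antisymm h1 (hcV θ hθ))
  · change V θ ≤ V θ'
    rw [(hVc θ hθ).2 hM]
    exact hcV θ' hθ'
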